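/- Let $G$ be a finite group. A $G$-lattice is a finitely generated free abelian group with a $\mathbb{Z}$-linear action of $G$. It is a permutation lattice if it has a finite $\mathbb{Z}$-basis permuted by $G$, invertible if it is a direct summand of a permutation $G$-lattice (with a $G$-lattice as complement), and flasque if $\hat H^{-1}(H,M)=0$ (Tate cohomology) for all subgroups $H\le G$. A flasque resolution of a $G$-lattice $M$ is a short exact sequence $0\to M\to P\to F\to 0$ of $G$-lattices with $P$ a permutation lattice and $F$ flasque. For a finite $G$-set $X$, let $\mathbb{Z}[X]$ be the associated permutation lattice, let $I_X=\ker(\mathbb{Z}[X]\to\mathbb{Z},\ x\mapsto 1)$, and let $J_X=(I_X)^*=\mathrm{Hom}(I_X,\mathbb{Z})$ be its $\mathbb{Z}$-dual, so that there are $G$-equivariant maps $\eta:\mathbb{Z}\to\mathbb{Z}[X]$, $1\mapsto\sum_{x\in X}x$, and $\pi:\mathbb{Z}[X]\to J_X$, sending $x$ to the functional "coefficient of $x$". Let $p$ be an odd prime, let $S_p$ act on $X_p=\{0,\dots,p-1\}$ in the natural way, and let $S_{p-2}\le S_p$ be the subgroup of permutations fixing the points $p-2$ and $p-1$. Then there is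 an isomorphism of $S_p$-lattices $\varphi: J_{X_p}\otimes\mathbb{Z}[X_p]\cong\mathbb{Z}[S_p/S_{p-2}]$ such that the sequence $$0\to J_{X_p}\to \mathbb{Z}[S_p/S_{p-2}]\to J_{X_p}^{\otimes 2}\to 0,$$ with maps $\varphi\circ(\mathrm{id}\otimes\eta)$ (where $J_{X_p}=J_{X_p}\otimes\mathbb{Z}$) and $(\mathrm{id}\otimes\pi)\circ\varphi^{-1}$, is a flasque resolution of the $S_p$-lattice $J_{X_p}$. Moreover, the $S_p$-lattice $J_{X_p}^{\otimes 2}$ is invertible. -/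

import Mathlib

open scoped MonoidAlgebra

noncomputable section

namespace GLattice

universe u

section Notions

variable {G : Type} [Group G]

/-- A `G`-lattice: a `ℤ`-linear action of `G` on a finitely generated free abelian group. -/
structure IsLattice {V : Type u} [AddCommGroup V] (ρ : Representation ℤ G V) : Prop where
  free : Module.Free ℤ V
  finite : Module.Finite ℤ V

/-- A permutation `G`-lattice: there is a finite `ℤ`-basis which is permuted by `G`. -/
def IsPermutation {V : Type u} [AddCommGroup V] (ρ : Representation ℤ G V) : Prop :=
  ∃ (n : ℕ) (b : Module.Basis (Fin n) ℤ V), ∀ (g : G) (i : Fin n), ∃ j : Fin n, ρ g (b i) = b j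

/-- An invertible `G`-lattice: a `G`-lattice which is a direct summand of a permutation
`G`-lattice. -/
def IsInvertible {V : Type u} [AddCommGroup V] (ρ : Representation ℤ G V) : Prop :=
  IsLattice ρ ∧
    ∃ (W : Type u) (_ : AddCommGroup W) (σ : Representation ℤ G W),
      IsLattice σ ∧ IsPermutation (ρ.prod σ)

/-- A flasque `G`-lattice, for a finite group `G`: a `G`-lattice `M` such that the Tate cohomology
group of degree `-1` of every subgroup of `G` with coefficients in `M` vanishes. -/
def IsFlasque [Finite G] {V : Type} [AddCommGroup V] (ρ : Representation ℤ G V) : Prop :=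
  IsLattice ρ ∧
    ∀ (H : Subgroup G) [Fintype H],
      Subsingleton (tateCohomology (Rep.of (ρ.comp H.subtype)) (-1))

/-- The sequence `0 → M → P → F → 0` with maps `f : M → P` and `q : P → F` is a flasque resolution
of the `G`-lattice `M`: it is a short exact sequence of `G`-lattices, `P` is a permutation lattice,
and `F` is flasque. -/
structure IsFlasqueResolution [Finite G] {M P F : Type}
    [AddCommGroup M] [AddCommGroup P] [AddCommGroup F]
    {ρM : Representation ℤ G M} {ρP : Representation ℤ G P} {ρF : Representation ℤ G F}
    (f : ρM.IntertwiningMap ρP) (q : ρP.IntertwiningMap ρF) : Prop where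
  lattice : IsLattice ρM
  permutation : IsPermutation ρP
  flasque : IsFlasque ρF
  injective : Function.Injective f
  exact : Function.Exact f q
  surjective : Function.Surjective q

end Notions

section PermutationLattice

variable (G : Type) [Group G] (X : Type) [MulAction G X]

/-- The augmentation `ℤ[X] → ℤ` of the permutation lattice of a `G`-set `X`, with `x ↦ 1`. -/
def augmentation :
    (Representation.ofMulAction ℤ G X).IntertwiningMap (Representation.trivial ℤ G ℤ) where
  toLinearMap := Finsupp.linearCombination ℤ (fun _ : X => (1 : ℤ)) ∘ₗ
    (MonoidAlgebra.coeffLinearEquiv ℤ).toLinearMap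
  isIntertwining' g := by ext; simp

/-- The augmentation sublattice `I_X`, the kernel of the augmentation. -/
abbrev augKer : Subrepresentation (Representation.ofMulAction ℤ G X) := (augmentation G X).ker

/-- The lattice `I_X` with its action of `G`. -/
abbrev latticeI : Representation ℤ G (augKer G X).toSubmodule := (augKer G X).toRepresentation

/-- The lattice `J_X`, the dual of `I_X`. -/
abbrev latticeJ : Representation ℤ G (Module.Dual ℤ (augKer G X).toSubmodule) :=
  (latticeI G X).dual

/-- The tensor square of `J_X`, with the diagonal action. -/
abbrev latticeJJ := (latticeJ G X).tprod (latticeJ G X)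

/-- The map `ℤ → ℤ[X]` with `1 ↦ ∑ x`, for a finite `G`-set `X`. -/
def orbitSum [Fintype X] :
    (Representation.trivial ℤ G ℤ).IntertwiningMap (Representation.ofMulAction ℤ G X) where
  toLinearMap := ∑ x : X, MonoidAlgebra.lsingle x
  isIntertwining' g := by
    ext1
    simp only [LinearMap.coe_comp, Function.comp_apply, Representation.trivial_apply,
      LinearMap.sum_apply, MonoidAlgebra.lsingle_apply, map_sum, Representation.ofMulAction_single]
    exact (Equiv.sum_comp (MulAction.toPerm g) fun x : X => MonoidAlgebra.single x (1 : ℤ)).symm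

/-- The map `ℤ[X] → J_X` sending `x` to the functional `m ↦` (coefficient of `x` in `m`); it is the
dual of the inclusion of `I_X` in the self-dual lattice `ℤ[X]`. -/
def permToJ :
    (Representation.ofMulAction ℤ G X).IntertwiningMap (latticeJ G X) where
  toLinearMap :=
    Finsupp.linearCombination ℤ
        (fun x : X => (Finsupp.lapply x ∘ₗ (MonoidAlgebra.coeffLinearEquiv ℤ).toLinearMap ∘ₗ
          (augKer G X).toSubmodule.subtype : Module.Dual ℤ (augKer G X).toSubmodule)) ∘ₗ
      (MonoidAlgebra.coeffLinearEquiv ℤ).toLinearMap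
  isIntertwining' g := by
    ext x m
    simp only [LinearMap.coe_comp, Function.comp_apply, MonoidAlgebra.lsingle_apply,
      Representation.ofMulAction_single, LinearEquiv.coe_coe,
      MonoidAlgebra.coeffLinearEquiv_apply, MonoidAlgebra.coeff_single,
      Finsupp.linearCombination_single, one_smul, Representation.dual_apply,
      Module.Dual.transpose_apply, Finsupp.lapply_apply, Submodule.subtype_apply]
    exact (by rw [Representation.coeff_ofMulAction, inv_inv] :
      (m : ℤ[X]).coeff (g • x) =
        (Representation.ofMulAction ℤ G X g⁻¹ (m : ℤ[X])).coeff x)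

/-- The map `J_X = J_X ⊗ ℤ → J_X ⊗ ℤ[X]` obtained by tensoring `ℤ → ℤ[X]` with `J_X`. -/
def tensorInl [Fintype X] :
    (latticeJ G X).IntertwiningMap ((latticeJ G X).tprod (Representation.ofMulAction ℤ G X)) :=
  ((orbitSum G X).lTensor (latticeJ G X)).comp
    (Representation.TensorProduct.rid ℤ (latticeJ G X)).symm.toIntertwiningMap

/-- The map `J_X ⊗ ℤ[X] → J_X ⊗ J_X` obtained by tensoring `ℤ[X] → J_X` with `J_X`. -/
def tensorProj :
    ((latticeJ G X).tprod (Representation.ofMulAction ℤ G X)).IntertwiningMap (latticeJJ G X) :=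
  (permToJ G X).lTensor (latticeJ G X)

end PermutationLattice

/-- The subgroup `S_m` of `S_n` (for `m ≤ n`): the permutations of `{0, …, n - 1}` which fix
`m, …, n - 1`. -/
abbrev symSubgroup (n m : ℕ) : Subgroup (Equiv.Perm (Fin n)) :=
  fixingSubgroup (Equiv.Perm (Fin n)) {i : Fin n | m ≤ (i : ℕ)}

end GLattice

end

noncomputable section

namespace GLattice

/-! ### Invertible lattices are flasque. -/

section Flasque

open CategoryTheory

/-! Write e_x for the image of x in J = J_X; the only relation is ∑ e_x = 0. Tensoring 0 → ℤ → ℤ[X]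
→ J → 0 with J gives the sequence. Its middle term is a permutation lattice because, for each y, the
e_x with x ≠ y form a basis of J, so the e_x ⊗ y with x ≠ y form a basis of J ⊗ ℤ[X] permuted like
the cosets of S_{p-2}.

Flasqueness of J ⊗ J follows from its invertibility, that is, from an equivariant factorization of
its identity through a permutation lattice. The scalars n for which n · id factors in this way form
an ideal, so two coprime ones suffice. For n = p, every point x gives an expansion of J ⊗ J in the
e_y ⊗ e_z based at x; sum over x (`Frame.factorsThroughPermutation_card`). For n = (p - 1)!, every
full cycle c gives a decomposition of the identity that depends on c naturally under conjugation
(`Frame.cycle_decomposition`); sum over all c (`Frame.factorsThroughPermutation_card_fullCycle`). -/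

/-- The Tate cohomology group of degree `-1` vanishes as soon as every element of norm zero
vanishes in the coinvariants. -/
lemma subsingleton_tateCohomology_neg_one {H : Type} [Group H] [Fintype H] {V : Type}
    [AddCommGroup V] (ρ : Representation ℤ H V)
    (hρ : ∀ x, ρ.norm x = 0 → x ∈ Representation.Coinvariants.ker ρ) :
    Subsingleton (tateCohomology (Rep.of ρ) (-1)) := by
  suffices Limits.IsZero (tateCohomology (Rep.of ρ) (-1)) from ModuleCat.subsingleton_of_isZero this
  change Limits.IsZero ((tateComplex (Rep.of ρ)).homology (-1))
  rw [← HomologicalComplex.exactAt_iff_isZero_homology,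
    HomologicalComplex.exactAt_iff' _ (-2) (-1) 0 (by simp) (by simp),
    ShortComplex.moduleCat_exact_iff]
  -- In degree -1 the Tate complex has the 0-chains; the norm leaves them and the differential from
  -- 1-chains enters.
  intro (x : (groupHomology.inhomogeneousChains (Rep.of ρ)).X 0) hx
  change (Rep.of ρ).tateNorm.hom x = 0 at hx
  change ∃ y, ((groupHomology.inhomogeneousChains (Rep.of ρ)).d 1 0).hom y = x
  set v := (groupHomology.chainsIso₀ (Rep.of ρ)).hom.hom x with hv
  have hnorm : ρ.norm v = 0 := by
    have := congrArg (groupCohomology.cochainsIso₀ (Rep.of ρ)).hom.hom hx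
    simpa [Rep.tateNorm, ← hv] using! this
  have hmem := hρ v hnorm
  change v ∈ Representation.Coinvariants.ker (Rep.of ρ).ρ at hmem
  rw [← groupHomology.range_d₁₀_eq_coinvariantsKer] at hmem
  obtain ⟨y, hy⟩ := hmem
  refine ⟨(groupHomology.chainsIso₁ (Rep.of ρ)).inv.hom y, ?_⟩
  have := congrArg (fun f => f.hom y) (groupHomology.eq_d₁₀_comp_inv (Rep.of ρ))
  simp only [ModuleCat.hom_comp, LinearMap.comp_apply] at this
  rw [this, hy, hv]
  simp

/-- In a permutation lattice, elements of norm zero vanish in the coinvariants. -/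
lemma mem_coinvariantsKer_of_norm_eq_zero {H : Type} [Group H] [Fintype H] {V : Type*}
    [AddCommGroup V] {ρ : Representation ℤ H V} (hρ : IsPermutation ρ) {x : V}
    (hx : ρ.norm x = 0) : x ∈ Representation.Coinvariants.ker ρ := by
  obtain ⟨n, b, hb⟩ := hρ
  let r : Setoid (Fin n) :=
    { r := fun i j => ∃ h, ρ h (b i) = b j
      iseqv :=
        { refl := fun i => ⟨1, by simp⟩
          symm := fun {i j} ⟨h, hh⟩ => ⟨h⁻¹, by rw [← hh]; simp⟩
          trans := fun {i j k} ⟨h, hh⟩ ⟨h', hh'⟩ => ⟨h' * h, by simp [hh, hh']⟩ } }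
  -- The coinvariants are free on the orbits of the basis: `q` projects to orbits and `s` picks
  -- representatives. As `q` turns the norm into multiplication by the order of H, torsion-freeness
  -- forces `q x = 0`.
  let q : V →ₗ[ℤ] (Quotient r →₀ ℤ) := b.constr ℤ fun i => Finsupp.single ⟦i⟧ 1
  let s : (Quotient r →₀ ℤ) →ₗ[ℤ] V := Finsupp.linearCombination ℤ fun t => b t.out
  have hq : ∀ h, q ∘ₗ ρ h = q := fun h => b.ext fun i => by
    obtain ⟨j, hj⟩ := hb h i
    have : (⟦j⟧ : Quotient r) = ⟦i⟧ := (Quotient.sound ⟨h, hj⟩ : (⟦i⟧ : Quotient r) = ⟦j⟧).symm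
    simp [q, hj, this]
  have hqx : q x = 0 := by
    have h0 : q (ρ.norm x) = 0 := by rw [hx, map_zero]
    have h1 : q (ρ.norm x) = (Fintype.card H : ℤ) • q x := by
      have h2 : ∀ h, q (ρ h x) = q x := fun h => LinearMap.congr_fun (hq h) x
      simp [Representation.norm, h2]
    rw [h1] at h0
    exact (smul_eq_zero.mp h0).resolve_left (by simp)
  have hs : (Representation.Coinvariants.ker ρ).mkQ ∘ₗ s ∘ₗ q =
      (Representation.Coinvariants.ker ρ).mkQ := b.ext fun i => by
    obtain ⟨h, hh⟩ := Quotient.mk_out (s := r) i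
    simp only [LinearMap.comp_apply, q, s, Module.Basis.constr_basis,
      Finsupp.linearCombination_single, one_smul, Submodule.mkQ_apply]
    refine ((Submodule.Quotient.eq _).mpr ?_).symm
    rw [← hh]
    exact Representation.Coinvariants.mem_ker_of_eq h _ _ rfl
  have := LinearMap.congr_fun hs x
  rw [LinearMap.comp_apply, LinearMap.comp_apply, hqx, map_zero, map_zero] at this
  simpa using this.symm

/-- An invertible lattice is flasque. -/
lemma IsInvertible.isFlasque {G : Type} [Group G] [Finite G] {V : Type} [AddCommGroup V]
    {ρ : Representation ℤ G V} (hρ : IsInvertible ρ) : IsFlasque ρ := by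
  obtain ⟨hl, W, _, σ, -, n, b, hb⟩ := hρ
  refine ⟨hl, fun H _ => subsingleton_tateCohomology_neg_one _ fun x hx => ?_⟩
  have hperm : IsPermutation ((ρ.prod σ).comp H.subtype) := ⟨n, b, fun g i => hb g i⟩
  have hx' : Representation.norm ((ρ.prod σ).comp H.subtype) (x, 0) = 0 := by
    simp only [Representation.norm, LinearMap.sum_apply] at hx ⊢
    ext
    · simpa [Prod.fst_sum] using hx
    · simp [Prod.snd_sum]
  have hle : Representation.Coinvariants.ker ((ρ.prod σ).comp H.subtype) ≤
      (Representation.Coinvariants.ker (ρ.comp H.subtype)).comap (LinearMap.fst ℤ V W) := by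
    refine Submodule.span_le.mpr ?_
    rintro _ ⟨⟨g, y⟩, rfl⟩
    exact Representation.Coinvariants.mem_ker_of_eq g y.1 _ rfl
  exact hle (mem_coinvariantsKer_of_norm_eq_zero hperm hx')

end Flasque

/-! ### Permutation lattices and maps that factor through them. -/

section Permutation

variable {G : Type} [Group G]

lemma IsPermutation.of_basis {ι : Type*} [Finite ι] {V : Type*} [AddCommGroup V]
    {ρ : Representation ℤ G V} (b : Module.Basis ι ℤ V) (hb : ∀ g i, ∃ j, ρ g (b i) = b j) :
    IsPermutation ρ := by
  refine ⟨Nat.card ι, b.reindex (Finite.equivFin ι), fun g i => ?_⟩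
  obtain ⟨j, hj⟩ := hb g ((Finite.equivFin ι).symm i)
  exact ⟨Finite.equivFin ι j, by simp [hj]⟩

lemma isPermutation_ofMulAction (S : Type) [MulAction G S] [Finite S] :
    IsPermutation (Representation.ofMulAction ℤ G S) :=
  .of_basis (Module.Basis.ofRepr (MonoidAlgebra.coeffLinearEquiv ℤ)) fun g s =>
    ⟨g • s, by simp⟩

lemma IsPermutation.of_equiv {V W : Type*} [AddCommGroup V] [AddCommGroup W]
    {ρ : Representation ℤ G V} {σ : Representation ℤ G W} (hρ : IsPermutation ρ)
    (e : ρ.Equiv σ) : IsPermutation σ := by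
  obtain ⟨n, b, hb⟩ := hρ
  refine ⟨n, b.map e.toLinearEquiv, fun g i => ?_⟩
  obtain ⟨j, hj⟩ := hb g i
  refine ⟨j, ?_⟩
  have := e.toIntertwiningMap.isIntertwining _ _ g (b i)
  rw [hj] at this
  simpa [Representation.Equiv.toLinearEquiv_apply] using this.symm

section Module

variable {R V : Type} [CommRing R] [AddCommGroup V] [Module R V]

/-- An endomorphism of a representation which factors equivariantly through a permutation
lattice `R[S]`:
the map to `R[S]` is given by a family of functionals `f`, the map from `R[S]` by a family of
vectors `v`. -/
def FactorsThroughPermutation (ρ : Representation R G V) (T : Module.End R V) : Prop :=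
  ∃ (S : Type) (_ : Fintype S) (a : G →* Equiv.Perm S) (f : S → Module.Dual R V) (v : S → V),
    (∀ g s x, f (a g s) (ρ g x) = f s x) ∧ (∀ g s, v (a g s) = ρ g (v s)) ∧
      ∀ x, T x = ∑ s, f s x • v s

variable {ρ : Representation R G V}

/-- Sums factor through the disjoint union of the two index sets. -/
lemma FactorsThroughPermutation.add {T T' : Module.End R V}
    (h : FactorsThroughPermutation ρ T) (h' : FactorsThroughPermutation ρ T') :
    FactorsThroughPermutation ρ (T + T') := by
  obtain ⟨S, _, a, f, v, hf, hv, hT⟩ := h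
  obtain ⟨S', _, a', f', v', hf', hv', hT'⟩ := h'
  refine ⟨S ⊕ S', inferInstance, (Equiv.Perm.sumCongrHom S S').comp (a.prod a'),
    Sum.elim f f', Sum.elim v v', ?_, ?_, ?_⟩
  · rintro g (s | s) x
    · simp [hf]
    · simp [hf']
  · rintro g (s | s)
    · simp [hv]
    · simp [hv']
  · intro x
    simp [hT, hT']

lemma FactorsThroughPermutation.smul {T : Module.End R V}
    (h : FactorsThroughPermutation ρ T) (c : R) : FactorsThroughPermutation ρ (c • T) := by
  obtain ⟨S, _, a, f, v, hf, hv, hT⟩ := h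
  exact ⟨S, inferInstance, a, f, fun s => c • v s, hf, by simp [hv], fun x => by
    simp [hT, Finset.smul_sum, smul_comm c]⟩

lemma FactorsThroughPermutation.zero : FactorsThroughPermutation ρ 0 :=
  ⟨Empty, inferInstance, 1, Empty.elim, Empty.elim, nofun, nofun, fun x => by simp⟩

lemma FactorsThroughPermutation.sum {ι : Type*} (s : Finset ι) {T : ι → Module.End R V}
    (h : ∀ i ∈ s, FactorsThroughPermutation ρ (T i)) : FactorsThroughPermutation ρ (∑ i ∈ s, T i) :=
  Finset.sum_induction T _ (fun _ _ => .add) .zero h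

lemma FactorsThroughPermutation.id_of_isCoprime {m n : R} (h : IsCoprime m n)
    (hm : FactorsThroughPermutation ρ (m • LinearMap.id))
    (hn : FactorsThroughPermutation ρ (n • LinearMap.id)) :
    FactorsThroughPermutation ρ LinearMap.id := by
  obtain ⟨a, b, hab⟩ := h
  have := (hm.smul a).add (hn.smul b)
  rwa [smul_smul, smul_smul, ← add_smul, hab, one_smul] at this

end Module

/-- A lattice is invertible if its identity factors through a permutation lattice. -/
lemma IsInvertible.of_factorsThroughPermutation {V : Type} [AddCommGroup V]
    {ρ : Representation ℤ G V} (hl : IsLattice ρ)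
    (h : FactorsThroughPermutation ρ LinearMap.id) : IsInvertible ρ := by
  obtain ⟨S, _, a, f, v, hf, hv, hT⟩ := h
  let _ : MulAction G S := MulAction.compHom S a
  let P := Representation.ofMulAction ℤ G S
  let α : V →ₗ[ℤ] ℤ[S] := ∑ s, MonoidAlgebra.lsingle s ∘ₗ f s
  let β₀ : ℤ[S] →ₗ[ℤ] V :=
    Finsupp.linearCombination ℤ v ∘ₗ (MonoidAlgebra.coeffLinearEquiv ℤ).toLinearMap
  have hβ₀ : ∀ g, β₀ ∘ₗ P g = ρ g ∘ₗ β₀ := fun g => by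
    ext s
    simpa [P, β₀] using! hv g s
  let β : P.IntertwiningMap ρ := ⟨β₀, hβ₀⟩
  have hα : ∀ g x, α (ρ g x) = P g (α x) := fun g x => by
    simp only [α, LinearMap.sum_apply, LinearMap.comp_apply, MonoidAlgebra.lsingle_apply, map_sum,
      P, Representation.ofMulAction_single]
    rw [← Equiv.sum_comp (a g)]
    exact Finset.sum_congr rfl fun s _ => by rw [hf]; rfl
  have hβα : ∀ x, β₀ (α x) = x := fun x => by
    simpa [α, β₀] using (hT x).symm
  have hfree : Module.Free ℤ ℤ[S] := .of_equiv (MonoidAlgebra.coeffLinearEquiv ℤ).symm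
  have hfin : Module.Finite ℤ ℤ[S] := .equiv (MonoidAlgebra.coeffLinearEquiv ℤ).symm
  refine ⟨hl, β.ker.toSubmodule, inferInstance, β.ker.toRepresentation, ⟨?_, ?_⟩, ?_⟩
  · infer_instance
  · infer_instance
  · let e : (V × β.ker.toSubmodule) ≃ₗ[ℤ] ℤ[S] :=
      LinearEquiv.ofLinearMap (α.coprod β.ker.toSubmodule.subtype)
        (β₀.prod ((LinearMap.id - α ∘ₗ β₀).codRestrict _ fun y => by
          change β₀ (y - α (β₀ y)) = 0
          rw [map_sub, hβα, sub_self]))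
        (by ext1; ext1; simp)
        (by
          refine LinearMap.ext fun ⟨x, y, hy⟩ => ?_
          replace hy : β₀ y = 0 := hy
          ext <;> simp [hβα, hy])
    refine (isPermutation_ofMulAction (G := G) S).of_equiv (Representation.Equiv.mk e ?_).symm
    refine fun g => LinearMap.ext fun ⟨x, y⟩ => ?_
    change α (ρ g x) + P g y = P g (α x + y)
    rw [hα, map_add]

end Permutation

open scoped TensorProduct

/-! ### Generators and relations of J_X, and exactness of ℤ → ℤ[X] → J_X. -/

section LatticeJ

variable (G : Type) [Group G] {X : Type} [MulAction G X]

lemma mem_augKer_iff (m : ℤ[X]) :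
    m ∈ (augKer G X).toSubmodule ↔ (Finsupp.linearCombination ℤ fun _ : X => (1 : ℤ)) m.coeff = 0 :=
  Iff.rfl

/-- The element `y - x` of `I_X`. -/
def root (y x : X) : (augKer G X).toSubmodule :=
  ⟨MonoidAlgebra.single y 1 - MonoidAlgebra.single x 1, by rw [mem_augKer_iff]; simp⟩

/-- The functional "coefficient of `x`" on `I_X`. -/
def coord (x : X) : Module.Dual ℤ (augKer G X).toSubmodule :=
  Finsupp.lapply x ∘ₗ (MonoidAlgebra.coeffLinearEquiv ℤ).toLinearMap ∘ₗ
    (augKer G X).toSubmodule.subtype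

lemma coord_apply (x : X) (m : (augKer G X).toSubmodule) : coord G x m = (m : ℤ[X]).coeff x := rfl

lemma permToJ_single (x : X) (c : ℤ) :
    permToJ G X (MonoidAlgebra.single x c) = c • coord G x := by
  change (permToJ G X).toLinearMap _ = _
  simp [permToJ, coord]

lemma latticeJ_coord (g : G) (x : X) : latticeJ G X g (coord G x) = coord G (g • x) := by
  have := (permToJ G X).isIntertwining _ _ g (MonoidAlgebra.single x 1)
  rw [Representation.ofMulAction_single, permToJ_single, permToJ_single, one_smul, one_smul] at this
  exact this.symm

lemma latticeJ_apply_root (g : G) (j : Module.Dual ℤ (augKer G X).toSubmodule) (y x : X) :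
    latticeJ G X g j (root G (g • y) (g • x)) = j (root G y x) := by
  simp only [Representation.dual_apply, Module.Dual.transpose_apply]
  change j _ = _
  congr 1
  ext1
  change Representation.ofMulAction ℤ G X g⁻¹ _ = _
  simp [root]

lemma coord_root [DecidableEq X] (i y x : X) :
    coord G i (root G y x) = (if y = i then 1 else 0) - (if x = i then 1 else 0) := by
  simp [coord_apply, root, MonoidAlgebra.coeff_single, Finsupp.single_apply]

lemma root_sub_root (y x o : X) : root G y o - root G x o = root G y x := by
  ext1
  simp [root]

variable [Fintype X]

lemma coeff_sum_eq_zero (m : (augKer G X).toSubmodule) : ∑ x, (m : ℤ[X]).coeff x = 0 := by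
  have := (mem_augKer_iff G _).mp m.2
  rw [Finsupp.linearCombination_apply, Finsupp.sum_fintype _ _ (by simp)] at this
  simpa using this

lemma sum_coord : ∑ x, coord G x = (0 : Module.Dual ℤ (augKer G X).toSubmodule) := by
  ext m
  simp only [LinearMap.sum_apply, coord_apply, LinearMap.zero_apply]
  exact coeff_sum_eq_zero G m

lemma eq_sum_root (m : (augKer G X).toSubmodule) (o : X) :
    m = ∑ x, (m : ℤ[X]).coeff x • root G x o := by
  classical
  ext y
  have h := coeff_sum_eq_zero G m
  simp [root, MonoidAlgebra.coeff_sum, Finsupp.single_apply, smul_sub,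
    Finset.sum_sub_distrib, h]

/-- Dual to `eq_sum_root`. The base point `o` is arbitrary, and its own term vanishes; this freedom
is what later allows summing over all base points. -/
lemma eq_sum_coord (j : Module.Dual ℤ (augKer G X).toSubmodule) (o : X) :
    ∑ x, j (root G x o) • coord G x = j := by
  ext m
  conv_rhs => rw [eq_sum_root G m o, map_sum]
  simp only [LinearMap.sum_apply, LinearMap.smul_apply, coord_apply, map_smul, smul_eq_mul, mul_comm]

lemma permToJ_surjective [Nonempty X] : Function.Surjective (permToJ G X) := fun j => by
  refine ⟨∑ x, MonoidAlgebra.single x (j (root G x (Classical.arbitrary X))), ?_⟩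
  rw [map_sum]
  simp only [permToJ_single]
  exact eq_sum_coord G j _

lemma orbitSum_apply (c : ℤ) : orbitSum G X c = ∑ x, MonoidAlgebra.single x c := by
  change (orbitSum G X).toLinearMap c = _
  simp [orbitSum]

lemma permToJ_apply_root (v : ℤ[X]) (y x : X) :
    permToJ G X v (root G y x) = v.coeff y - v.coeff x := by
  classical
  have hv : v = ∑ x, MonoidAlgebra.single x (v.coeff x) := by
    ext z
    simp [MonoidAlgebra.coeff_sum]
  conv_lhs => rw [hv, map_sum]
  simp [permToJ_single, coord_root, mul_sub, Finset.sum_sub_distrib]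

lemma orbitSum_permToJ_exact [Nonempty X] : Function.Exact (orbitSum G X) (permToJ G X) := by
  classical
  intro v
  constructor
  · intro hv
    refine ⟨v.coeff (Classical.arbitrary X), ?_⟩
    rw [orbitSum_apply]
    ext y
    have := permToJ_apply_root G v y (Classical.arbitrary X)
    rw [hv] at this
    simp only [LinearMap.zero_apply] at this
    replace this := sub_eq_zero.mp this.symm
    simp [MonoidAlgebra.coeff_sum, this]
  · rintro ⟨c, rfl⟩
    rw [orbitSum_apply, map_sum]
    simp only [permToJ_single, ← Finset.smul_sum, sum_coord, smul_zero]

lemma isLattice_latticeJ : IsLattice (latticeJ G X) := by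
  have hfree : Module.Free ℤ ℤ[X] := .of_equiv (MonoidAlgebra.coeffLinearEquiv ℤ).symm
  have hfin : Module.Finite ℤ ℤ[X] := .equiv (MonoidAlgebra.coeffLinearEquiv ℤ).symm
  exact ⟨inferInstance, inferInstance⟩

lemma isLattice_latticeJJ : IsLattice (latticeJJ G X) := by
  have := (isLattice_latticeJ G (X := X)).free
  have := (isLattice_latticeJ G (X := X)).finite
  exact ⟨Module.Free.tensor (S := ℤ), Module.Finite.tensorProduct ℤ _ _⟩
end LatticeJ

/-! ### Abstract frames and the multiple |X| of the identity. -/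

section Frames

variable {R G X V : Type} [CommRing R] [Group G] [MulAction G X] [Fintype X]
  [AddCommGroup V] [Module R V]

/-- An equivariant family of vectors `coord x` together with functionals `root y x` which behave
like the generators of `J_X` and the differences `y - x` in `I_X`. -/
structure Frame (ρ : Representation R G V) (X : Type) [MulAction G X] [Fintype X] where
  coord : X → V
  root : X → X → Module.Dual R V
  apply_coord : ∀ g x, ρ g (coord x) = coord (g • x)
  root_apply : ∀ g y x v, root (g • y) (g • x) (ρ g v) = root y x v
  root_sub_root : ∀ y x o, root y o - root x o = root y x
  root_coord : ∀ [DecidableEq X] i y x,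
    root y x (coord i) = (if y = i then 1 else 0) - (if x = i then 1 else 0)
  sum_coord : ∑ x, coord x = 0
  sum_root_smul_coord : ∀ v o, ∑ y, root y o v • coord y = v

namespace Frame

variable {ρ : Representation R G V} (F : Frame ρ X)

/-- The functional on `V ⊗ V` given by a pair of roots. -/
def pairing (y x y' x' : X) : Module.Dual R (V ⊗[R] V) :=
  LinearMap.mul' R R ∘ₗ TensorProduct.map (F.root y x) (F.root y' x')

lemma pairing_tmul (y x y' x' : X) (v w : V) :
    F.pairing y x y' x' (v ⊗ₜ w) = F.root y x v * F.root y' x' w := by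
  simp [pairing]

lemma pairing_apply (g : G) (y x y' x' : X) (t : V ⊗[R] V) :
    F.pairing (g • y) (g • x) (g • y') (g • x') (ρ.tprod ρ g t) = F.pairing y x y' x' t := by
  induction t with
  | zero => simp only [map_zero]
  | add t t' h h' => simp only [map_add, h, h']
  | tmul v w =>
    rw [Representation.tprod_apply, TensorProduct.map_tmul, pairing_tmul, pairing_tmul,
      root_apply, root_apply]

lemma apply_coord_tmul (g : G) (x y : X) :
    ρ.tprod ρ g (F.coord x ⊗ₜ F.coord y) = F.coord (g • x) ⊗ₜ F.coord (g • y) := by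
  rw [Representation.tprod_apply, TensorProduct.map_tmul, apply_coord, apply_coord]

lemma tensor_ext [Nonempty X] {W : Type*} [AddCommGroup W] [Module R W]
    {f f' : V ⊗[R] V →ₗ[R] W}
    (h : ∀ x y, f (F.coord x ⊗ₜ F.coord y) = f' (F.coord x ⊗ₜ F.coord y)) : f = f' := by
  refine TensorProduct.ext' fun v w => ?_
  rw [← F.sum_root_smul_coord v (Classical.arbitrary X),
    ← F.sum_root_smul_coord w (Classical.arbitrary X)]
  simp only [TensorProduct.sum_tmul, TensorProduct.tmul_sum, ← TensorProduct.smul_tmul',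
    TensorProduct.tmul_smul, map_sum, map_smul, h]

include F in
/-- Multiplication by the number of points of `X` on `V ⊗ V` factors through the permutation
lattice on `X × X × X`. -/
lemma factorsThroughPermutation_card :
    FactorsThroughPermutation (ρ.tprod ρ) ((Fintype.card X : R) • LinearMap.id) := by
  refine ⟨X × X × X, inferInstance, MulAction.toPermHom G _,
    fun s => F.pairing s.2.1 s.1 s.2.2 s.1, fun s => F.coord s.2.1 ⊗ₜ F.coord s.2.2,
    fun g s t => F.pairing_apply g _ _ _ _ t,
    fun g s => (F.apply_coord_tmul g _ _).symm, fun t => ?_⟩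
  induction t with
  | zero => simp only [map_zero, zero_smul, Finset.sum_const_zero]
  | add t t' h h' => simp only [map_add, h, h', add_smul, Finset.sum_add_distrib]
  | tmul v w =>
    -- Each base point `x` recovers `v ⊗ w`, so the sum over `x` yields |X| copies.
    have key : ∀ x : X, ∑ y, ∑ z,
        F.pairing y x z x (v ⊗ₜ w) • F.coord y ⊗ₜ[R] F.coord z = v ⊗ₜ[R] w := fun x => by
      conv_rhs => rw [← F.sum_root_smul_coord v x, ← F.sum_root_smul_coord w x]
      rw [TensorProduct.sum_tmul]
      simp only [TensorProduct.tmul_sum, pairing_tmul, mul_smul, TensorProduct.tmul_smul,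
        ← TensorProduct.smul_tmul']
      exact Finset.sum_congr rfl fun y _ => Finset.sum_congr rfl fun z _ => smul_comm _ _ _
    simp only [Fintype.sum_prod_type]
    refine Eq.trans ?_ (Finset.sum_congr rfl fun x _ => (key x).symm)
    simp [Nat.cast_smul_eq_nsmul]

end Frame

end Frames

/-! ### Full cycles and the multiple (|X| - 1)! of the identity. -/

section Cycles

open Equiv

/-- The full cycles on `X`. -/
abbrev FullCycle (X : Type) [Fintype X] [DecidableEq X] :=
  {c : Perm X // c.cycleType = {Fintype.card X}}

namespace FullCycle

variable {X : Type} [Fintype X] [DecidableEq X]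

/-- The action of the permutations on the full cycles by conjugation. -/
def conj (X : Type) [Fintype X] [DecidableEq X] : Perm X →* Perm (FullCycle X) where
  toFun g := (MulAut.conj g).toEquiv.subtypeEquiv fun c => by simp [Perm.cycleType_conj]
  map_one' := by ext; simp
  map_mul' g h := by ext; simp

lemma coe_conj (g : Perm X) (c : FullCycle X) : (conj X g c : Perm X) = g * c * g⁻¹ := rfl

/-- A full cycle acts simply transitively through its powers: d ↦ cᵈ x is a bijection from {0, …,
|X| - 1} to X. -/
lemma sum_pow_apply {M : Type*} [AddCommMonoid M] (c : FullCycle X) (x : X) (h : X → M) :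
    ∑ d ∈ Finset.range (Fintype.card X), h ((c.1 ^ d) x) = ∑ y, h y := by
  have hc : c.1.IsCycle := by
    rw [← Perm.card_cycleType_eq_one, c.2, Multiset.card_singleton]
  have hs : c.1.support = Finset.univ := by
    rw [← Finset.card_eq_iff_eq_univ, ← Perm.sum_cycleType, c.2, Multiset.sum_singleton]
  have hon : c.1.IsCycleOn (Finset.univ : Finset X) := by
    convert hc.isCycleOn using 1
    ext y
    have : y ∈ c.1.support := by rw [hs]; exact Finset.mem_univ y
    simpa using this
  have himg : (Finset.range (Fintype.card X)).image (fun d => (c.1 ^ d) x) = Finset.univ := by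
    ext y
    obtain ⟨d, hd, hy⟩ := hon.exists_pow_eq (Finset.mem_univ x) (Finset.mem_univ y)
    simp only [Finset.mem_image, Finset.mem_range, Finset.mem_univ, iff_true]
    exact ⟨d, by simpa using hd, hy⟩
  rw [← himg, Finset.sum_image]
  intro d hd e he hde
  have := (hon.pow_apply_eq_pow_apply (Finset.mem_univ x)).mp hde
  simp only [Finset.coe_range, Set.mem_Iio, Finset.card_univ] at hd he this
  exact this.eq_of_lt_of_lt hd he

lemma card_eq (h : 2 ≤ Fintype.card X) :
    Fintype.card (FullCycle X) = (Fintype.card X - 1).factorial := by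
  rw [Fintype.card_subtype, Perm.card_of_cycleType_singleton h le_rfl, Nat.choose_self, mul_one]

end FullCycle

namespace Frame

variable {R X V : Type} [CommRing R] [Fintype X] [AddCommGroup V] [Module R V]
  {ρ : Representation R (Perm X) V} (F : Frame ρ X)

/-- The functional `∑ᵢ eᵢ ⊗ (e_{c i} - eᵢ)`, written with respect to a base point `o`. -/
def cycleFunctional (c : Perm X) (o : X) : Module.Dual R (V ⊗[R] V) :=
  ∑ i, F.pairing i o (c i) i

/-- The functional `∑_{a < d} (eₓ - e_{cᵃ x}) ⊗ (e_{cᵃ⁺¹ x} - e_{cᵃ x})`. -/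
def pathFunctional (c : Perm X) (x : X) (d : ℕ) : Module.Dual R (V ⊗[R] V) :=
  ∑ a ∈ Finset.range d, F.pairing x ((c ^ a) x) ((c ^ (a + 1)) x) ((c ^ a) x)

/-- The vector of `V ⊗ V` which goes with `cycleFunctional`. -/
def cycleVector (c : Perm X) (x : X) : V ⊗[R] V :=
  ∑ d ∈ Finset.range (Fintype.card X), ∑ a ∈ Finset.range d,
    F.coord ((c⁻¹ ^ a) x) ⊗ₜ F.coord ((c ^ d) ((c⁻¹ ^ a) x))

lemma sum_root_cycle (c : Perm X) (v : V) : ∑ i, F.root (c i) i v = 0 := by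
  rcases isEmpty_or_nonempty X with _ | _
  · simp
  · have h : ∀ i, F.root (c i) i v =
        F.root (c i) (Classical.arbitrary X) v - F.root i (Classical.arbitrary X) v := fun i => by
      rw [← LinearMap.sub_apply, F.root_sub_root]
    rw [Finset.sum_congr rfl fun i _ => h i, Finset.sum_sub_distrib,
      Equiv.sum_comp c fun i => F.root i (Classical.arbitrary X) v, sub_self]

/-- Moving the base point adds a fixed root tensored with ∑ᵢ (e_{c i} - eᵢ), which is zero because c
permutes X. Without this independence the functional would not be natural in c. -/
lemma cycleFunctional_eq (c : Perm X) (o o' : X) :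
    F.cycleFunctional c o = F.cycleFunctional c o' := by
  refine TensorProduct.ext' fun v w => ?_
  simp only [cycleFunctional, LinearMap.sum_apply, pairing_tmul]
  rw [← sub_eq_zero, ← Finset.sum_sub_distrib]
  have : ∀ i, F.root i o v - F.root i o' v = F.root o' o v := fun i => by
    rw [← LinearMap.sub_apply, ← F.root_sub_root i o' o]
    simp
  simp only [← sub_mul, this, ← Finset.mul_sum, sum_root_cycle, mul_zero]

omit [Fintype X] in
lemma conj_pow_apply (g c : Perm X) (n : ℕ) (x : X) :
    ((g * c * g⁻¹) ^ n) (g x) = g ((c ^ n) x) := by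
  simp [conj_pow]

lemma cycleFunctional_conj (g c : Perm X) (o : X) (t : V ⊗[R] V) :
    F.cycleFunctional (g * c * g⁻¹) o (ρ.tprod ρ g t) = F.cycleFunctional c o t := by
  rw [F.cycleFunctional_eq _ o (g o)]
  simp only [cycleFunctional, LinearMap.sum_apply]
  rw [← Equiv.sum_comp g]
  refine Finset.sum_congr rfl fun i _ => ?_
  rw [← F.pairing_apply g _ _ _ _ t]
  simp

lemma pathFunctional_conj (g c : Perm X) (x : X) (d : ℕ) (t : V ⊗[R] V) :
    F.pathFunctional (g * c * g⁻¹) (g x) d (ρ.tprod ρ g t) = F.pathFunctional c x d t := by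
  simp only [pathFunctional, LinearMap.sum_apply]
  refine Finset.sum_congr rfl fun a _ => ?_
  rw [← F.pairing_apply g _ _ _ _ t]
  simp only [conj_pow_apply, Perm.smul_def]

lemma cycleVector_conj (g c : Perm X) (x : X) :
    F.cycleVector (g * c * g⁻¹) (g x) = ρ.tprod ρ g (F.cycleVector c x) := by
  have h : (g * c * g⁻¹)⁻¹ = g * c⁻¹ * g⁻¹ := by group
  simp only [cycleVector, map_sum, apply_coord_tmul, h, conj_pow_apply, Perm.smul_def]

variable [DecidableEq X]

/-- Shifting x along the cycle makes the inner sums telescope; the boundary terms, summed over d,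
contain the factor ∑ e_y = 0. -/
lemma cycleVector_apply (c : FullCycle X) (x : X) :
    F.cycleVector c.1 (c.1 x) = F.cycleVector c.1 x := by
  rw [← sub_eq_zero]
  simp only [cycleVector, ← Finset.sum_sub_distrib]
  have h1 : ∀ a, (c.1⁻¹ ^ (a + 1)) (c.1 x) = (c.1⁻¹ ^ a) x := fun a => by simp [pow_succ]
  have h2 : ∀ d, ∑ a ∈ Finset.range d,
      (F.coord ((c.1⁻¹ ^ a) (c.1 x)) ⊗ₜ[R] F.coord ((c.1 ^ d) ((c.1⁻¹ ^ a) (c.1 x))) -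
        F.coord ((c.1⁻¹ ^ a) x) ⊗ₜ[R] F.coord ((c.1 ^ d) ((c.1⁻¹ ^ a) x))) =
      F.coord (c.1 x) ⊗ₜ[R] F.coord ((c.1 ^ d) (c.1 x)) -
        F.coord ((c.1⁻¹ ^ d) (c.1 x)) ⊗ₜ[R] F.coord (c.1 x) := fun d => by
    simp only [← h1]
    rw [Finset.sum_range_sub' fun a =>
      F.coord ((c.1⁻¹ ^ a) (c.1 x)) ⊗ₜ[R] F.coord ((c.1 ^ d) ((c.1⁻¹ ^ a) (c.1 x)))]
    simp
  simp only [h2, Finset.sum_sub_distrib]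
  rw [← TensorProduct.tmul_sum, ← TensorProduct.sum_tmul, FullCycle.sum_pow_apply c _ F.coord,
    FullCycle.sum_pow_apply ⟨c.1⁻¹, by rw [Perm.cycleType_inv, c.2]⟩ _ F.coord, F.sum_coord]
  simp

lemma cycleVector_eq (c : FullCycle X) (x y : X) :
    F.cycleVector c.1 x = F.cycleVector c.1 y := by
  have h : ∀ n : ℕ, F.cycleVector c.1 ((c.1 ^ n) y) = F.cycleVector c.1 y := fun n => by
    induction n with
    | zero => simp
    | succ n ih => rw [pow_succ', Perm.mul_apply, cycleVector_apply, ih]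
  -- Summing the indicator of `x` along the cycle produces a power of c that carries `y` to `x`.
  have := FullCycle.sum_pow_apply c y fun z => if z = x then 1 else 0
  rw [Finset.sum_ite_eq' Finset.univ x, if_pos (Finset.mem_univ x)] at this
  obtain ⟨d, -, hd⟩ := Finset.exists_ne_zero_of_sum_ne_zero (this.trans_ne one_ne_zero)
  have hx : (c.1 ^ d) y = x := by simpa using hd
  rw [← hx, h]

/-- The value of `pathFunctional` on the generators of `V ⊗ V`. -/
lemma pathFunctional_coord (c : Perm X) (x i j : X) (d : ℕ) :
    F.pathFunctional c x d (F.coord i ⊗ₜ F.coord j) =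
      (if x = i then ((if (c ^ d) i = j then 1 else 0) - (if i = j then 1 else 0)) else 0) -
        ∑ a ∈ Finset.range d, if x = (c⁻¹ ^ a) i then
          (if c i = j then 1 else 0) - (if i = j then 1 else 0) else 0 := by
  simp only [pathFunctional, LinearMap.sum_apply, pairing_tmul, root_coord, sub_mul _ _ (_ - _)]
  -- The part with the fixed factor eₓ telescopes along the path from x to cᵈ x.
  rw [Finset.sum_sub_distrib, ← Finset.mul_sum,
    Finset.sum_range_sub fun a => if (c ^ a) x = j then (1 : R) else 0]
  congr 1
  · by_cases h : x = i <;> simp [h]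
  · refine Finset.sum_congr rfl fun a _ => ?_
    have hiff : x = (c⁻¹ ^ a) i ↔ (c ^ a) x = i := by
      rw [inv_pow, Perm.eq_inv_iff_eq]
    by_cases h : (c ^ a) x = i
    · rw [if_pos (hiff.mpr h), pow_succ', Perm.mul_apply, h, if_pos rfl, one_mul]
    · rw [if_neg (hiff.not.mpr h), if_neg h, zero_mul]

lemma cycleFunctional_coord (c : Perm X) (o i j : X) :
    F.cycleFunctional c o (F.coord i ⊗ₜ F.coord j) =
      (if c i = j then 1 else 0) - (if i = j then 1 else 0) := by
  simp only [cycleFunctional, LinearMap.sum_apply, pairing_tmul, root_coord, sub_mul _ _ (_ - _)]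
  rw [Finset.sum_sub_distrib, ← Finset.mul_sum, Finset.sum_sub_distrib (s := Finset.univ)]
  rw [Equiv.sum_comp c fun i => if i = j then (1 : R) else 0, sub_self, mul_zero, sub_zero]
  simp

/-- The decomposition of the identity of `V ⊗ V` attached to a full cycle. -/
lemma cycle_decomposition (c : FullCycle X) (o : X) (t : V ⊗[R] V) :
    (∑ d ∈ Finset.range (Fintype.card X), ∑ x, F.pathFunctional c.1 x d t •
        F.coord x ⊗ₜ[R] F.coord ((c.1 ^ d) x)) +
      F.cycleFunctional c.1 o t • F.cycleVector c.1 o = t := by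
  have : Nonempty X := ⟨o⟩
  suffices h : (∑ d ∈ Finset.range (Fintype.card X), ∑ x,
      (F.pathFunctional c.1 x d).smulRight (F.coord x ⊗ₜ[R] F.coord ((c.1 ^ d) x))) +
      (F.cycleFunctional c.1 o).smulRight (F.cycleVector c.1 o) = LinearMap.id by
    simpa using LinearMap.congr_fun h t
  refine F.tensor_ext fun i j => ?_
  simp only [LinearMap.add_apply, LinearMap.sum_apply, LinearMap.smulRight_apply,
    pathFunctional_coord, cycleFunctional_coord, LinearMap.id_apply]
  -- On e_i ⊗ e_j the path terms split in two. The subtracted parts add up over d to a multiple of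
  -- the cycle vector based at i, cancelled by the cycle term; the rest becomes e_i ⊗ e_j by ∑ e_y =
  -- 0.
  have h1 : ∀ d, ∑ x, ((if x = i then
      ((if (c.1 ^ d) i = j then (1 : R) else 0) - (if i = j then 1 else 0)) else 0) -
        ∑ a ∈ Finset.range d, if x = (c.1⁻¹ ^ a) i then
          (if c.1 i = j then 1 else 0) - (if i = j then 1 else 0) else 0) •
        F.coord x ⊗ₜ[R] F.coord ((c.1 ^ d) x) =
      ((if (c.1 ^ d) i = j then (1 : R) else 0) - (if i = j then 1 else 0)) •
        F.coord i ⊗ₜ[R] F.coord ((c.1 ^ d) i) -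
      ((if c.1 i = j then (1 : R) else 0) - (if i = j then 1 else 0)) •
        ∑ a ∈ Finset.range d,
          F.coord ((c.1⁻¹ ^ a) i) ⊗ₜ[R] F.coord ((c.1 ^ d) ((c.1⁻¹ ^ a) i)) := fun d => by
    simp only [sub_smul _ (Finset.sum _ _), Finset.sum_smul, ite_smul, zero_smul]
    rw [Finset.sum_sub_distrib, Finset.sum_ite_eq' Finset.univ i, if_pos (Finset.mem_univ i),
      Finset.sum_comm, Finset.smul_sum]
    congr 1
    refine Finset.sum_congr rfl fun a _ => ?_
    rw [Finset.sum_ite_eq' Finset.univ, if_pos (Finset.mem_univ _)]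
  simp only [h1]
  rw [Finset.sum_sub_distrib, ← Finset.smul_sum, F.cycleVector_eq c o i, cycleVector,
    sub_add_cancel]
  rw [FullCycle.sum_pow_apply c i fun y =>
    ((if y = j then (1 : R) else 0) - (if i = j then 1 else 0)) • F.coord i ⊗ₜ[R] F.coord y]
  simp only [sub_smul, Finset.sum_sub_distrib]
  rw [← Finset.smul_sum, ← TensorProduct.tmul_sum, F.sum_coord, TensorProduct.tmul_zero, smul_zero,
    sub_zero]
  simp only [ite_smul, one_smul, zero_smul]
  rw [Finset.sum_ite_eq' Finset.univ j, if_pos (Finset.mem_univ j)]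

include F in
/-- Multiplication by the number of full cycles on `V ⊗ V` factors through a permutation
lattice. -/
lemma factorsThroughPermutation_card_fullCycle [Nonempty X] :
    FactorsThroughPermutation (ρ.tprod ρ) ((Fintype.card (FullCycle X) : R) • LinearMap.id) := by
  have o : X := Classical.arbitrary X
  have h1 : ∀ d ∈ Finset.range (Fintype.card X), FactorsThroughPermutation (ρ.tprod ρ)
      (∑ s : FullCycle X × X, (F.pathFunctional s.1.1 s.2 d).smulRight
        (F.coord s.2 ⊗ₜ[R] F.coord ((s.1.1 ^ d) s.2))) := fun d _ => by
    refine ⟨FullCycle X × X, inferInstance,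
      { toFun := fun g => (FullCycle.conj X g).prodCongr g
        map_one' := by ext <;> simp
        map_mul' := fun g h => by ext <;> simp },
      fun s => F.pathFunctional s.1.1 s.2 d,
      fun s => F.coord s.2 ⊗ₜ F.coord ((s.1.1 ^ d) s.2), ?_, ?_, ?_⟩
    · rintro g ⟨c, x⟩ t
      exact F.pathFunctional_conj g c x d t
    · rintro g ⟨c, x⟩
      rw [apply_coord_tmul]
      simp [FullCycle.coe_conj]
    · intro t
      simp
  have h2 : FactorsThroughPermutation (ρ.tprod ρ)
      (∑ c : FullCycle X, (F.cycleFunctional c.1 o).smulRight (F.cycleVector c.1 o)) := by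
    refine ⟨FullCycle X, inferInstance, FullCycle.conj X, fun c => F.cycleFunctional c.1 o,
      fun c => F.cycleVector c.1 o, ?_, ?_, ?_⟩
    · intro g c t
      exact F.cycleFunctional_conj g c o t
    · intro g c
      -- Conjugation moves the base point to `g o`; independence of it brings `o` back.
      exact (F.cycleVector_eq (FullCycle.conj X g c) o (g o)).trans (F.cycleVector_conj g c o)
    · intro t
      simp
  convert (FactorsThroughPermutation.sum _ h1).add h2 using 1
  refine LinearMap.ext fun t => ?_
  simp only [LinearMap.add_apply, LinearMap.sum_apply, LinearMap.smulRight_apply,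
    LinearMap.smul_apply, LinearMap.id_apply, Fintype.sum_prod_type]
  rw [Finset.sum_comm, ← Finset.sum_add_distrib]
  simp only [F.cycle_decomposition]
  simp [Nat.cast_smul_eq_nsmul]

end Frame

end Cycles

/-! ### V ⊗ R[X] as the permutation module on pairs of distinct points. -/

section OffDiagonal

variable {R G X V : Type} [CommRing R] [Group G] [MulAction G X] [Fintype X]
  [AddCommGroup V] [Module R V] {ρ : Representation R G V}

/-- The linear isomorphism between `V ⊗ R[X]` and `R[S]`, where `S` parametrises the pairs of
distinct points of `X`. -/
def Frame.tensorLinearEquiv (F : Frame ρ X) {S : Type} [Fintype S] (pt : S → X × X)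
    (hinj : Function.Injective pt) (hrange : ∀ z, z ∈ Set.range pt ↔ z.1 ≠ z.2) :
    V ⊗[R] R[X] ≃ₗ[R] R[S] :=
  LinearEquiv.ofLinearMap
    (∑ s, MonoidAlgebra.lsingle s ∘ₗ LinearMap.mul' R R ∘ₗ
      TensorProduct.map (F.root (pt s).1 (pt s).2)
        (Finsupp.lapply (pt s).2 ∘ₗ (MonoidAlgebra.coeffLinearEquiv R).toLinearMap))
    (Finsupp.linearCombination R (fun s => F.coord (pt s).1 ⊗ₜ MonoidAlgebra.single (pt s).2 1) ∘ₗ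
      (MonoidAlgebra.coeffLinearEquiv R).toLinearMap)
    (by
      classical
      ext s : 2
      have hs : (pt s).1 ≠ (pt s).2 := (hrange _).mp ⟨s, rfl⟩
      -- When the second entries agree, the negative term of the root vanishes because the entries
      -- of a pair are distinct; a Kronecker delta remains.
      have h : ∀ s', F.root (pt s').1 (pt s').2 (F.coord (pt s).1) *
          (if (pt s).2 = (pt s').2 then (1 : R) else 0) = if s' = s then 1 else 0 := fun s' => by
        rw [F.root_coord]
        by_cases h2 : (pt s).2 = (pt s').2
        · have : (pt s').2 ≠ (pt s).1 := fun h => hs (h.symm.trans h2.symm)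
          rw [if_neg this, if_pos h2, sub_zero, mul_one]
          refine if_congr ⟨fun h => hinj (Prod.ext h h2.symm), fun h => by rw [h]⟩ rfl rfl
        · rw [if_neg h2, mul_zero, if_neg]
          rintro rfl
          exact h2 rfl
      simp only [LinearMap.comp_apply, MonoidAlgebra.lsingle_apply, LinearEquiv.coe_coe,
        MonoidAlgebra.coeffLinearEquiv_apply, MonoidAlgebra.coeff_single,
        Finsupp.linearCombination_single, one_smul, LinearMap.sum_apply, TensorProduct.map_tmul,
        LinearMap.mul'_apply, Finsupp.lapply_apply, Finsupp.single_apply, h, LinearMap.id_apply]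
      rw [Finset.sum_eq_single s (fun s' _ hs' => by simp [hs']) (by simp), if_pos rfl])
    (by
      classical
      ext v x
      -- Diagonal pairs carry the zero root, so the sum over `S` extends to all of X × X, where the
      -- expansion of `v` applies.
      have h : ∀ z : X × X, z ∉ Set.range pt →
          F.root z.1 z.2 v • (if x = z.2 then (1 : R) else 0) •
            F.coord z.1 ⊗ₜ[R] (MonoidAlgebra.single z.2 1 : R[X]) = 0 := fun z hz => by
        have hz' : z.1 = z.2 := by simpa [hrange] using hz
        have := F.root_sub_root z.2 z.2 z.2
        rw [sub_self] at this
        rw [hz', ← this, LinearMap.zero_apply, zero_smul]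
      have h2 := Finset.sum_subset (Finset.subset_univ (Finset.univ.image pt)) fun z _ hz =>
        h z (by simpa using hz)
      rw [Finset.sum_image hinj.injOn, Fintype.sum_prod_type] at h2
      simp only [ite_smul, one_smul, zero_smul, smul_ite, smul_zero, Finset.sum_ite_eq,
        Finset.mem_univ, if_true] at h2
      simp only [TensorProduct.smul_tmul', ← TensorProduct.sum_tmul, F.sum_root_smul_coord] at h2
      refine Eq.trans ?_ h2
      simp [Finsupp.single_apply, TensorProduct.smul_tmul', ite_smul])

/-- The isomorphism between `V ⊗ R[X]` and the permutation representation on the pairs of distinct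
points of `X`. -/
def Frame.tensorEquiv (F : Frame ρ X) {S : Type} [Fintype S] [MulAction G S] (pt : S → X × X)
    (hinj : Function.Injective pt) (hrange : ∀ z, z ∈ Set.range pt ↔ z.1 ≠ z.2)
    (hsmul : ∀ (g : G) s, pt (g • s) = g • pt s) :
    (ρ.tprod (Representation.ofMulAction R G X)).Equiv (Representation.ofMulAction R G S) :=
  -- Equivariance is checked on the inverse, which sends basis elements to pure tensors.
  (Representation.Equiv.mk (ρ := Representation.ofMulAction R G S)
    (σ := ρ.tprod (Representation.ofMulAction R G X))
    (F.tensorLinearEquiv pt hinj hrange).symm fun g => by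
    ext s
    change (F.tensorLinearEquiv pt hinj hrange).symm.toLinearMap _ = _
    simp [Frame.tensorLinearEquiv, hsmul, F.apply_coord]).symm

end OffDiagonal

/-! ### Cosets of S_{p-2} as ordered pairs of distinct points. -/

section Cosets

/-- The images of the last two points under a coset of `S_{p-2}`. -/
def lastTwo (p : ℕ) (hp : 2 ≤ p) :
    Equiv.Perm (Fin p) ⧸ symSubgroup p (p - 2) → Fin p × Fin p :=
  Quotient.lift (fun g => (g ⟨p - 2, by omega⟩, g ⟨p - 1, by omega⟩)) fun g g' h => by
    have h' : g⁻¹ * g' ∈ symSubgroup p (p - 2) := QuotientGroup.leftRel_apply.mp h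
    rw [mem_fixingSubgroup_iff] at h'
    have h1 := h' ⟨p - 2, by omega⟩ (le_refl (p - 2))
    have h2 := h' ⟨p - 1, by omega⟩ (Nat.sub_le_sub_left one_le_two p)
    rw [Equiv.Perm.smul_def, Equiv.Perm.mul_apply, Equiv.Perm.inv_eq_iff_eq] at h1 h2
    rw [h1, h2]

variable {p : ℕ} (hp : 2 ≤ p)

lemma lastTwo_smul (g : Equiv.Perm (Fin p)) (s : Equiv.Perm (Fin p) ⧸ symSubgroup p (p - 2)) :
    lastTwo p hp (g • s) = g • lastTwo p hp s := by
  induction s using Quotient.inductionOn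
  rfl

lemma lastTwo_injective : Function.Injective (lastTwo p hp) := by
  intro s s' h
  induction s using Quotient.inductionOn with | _ g
  induction s' using Quotient.inductionOn with | _ g'
  obtain ⟨h1, h2⟩ := Prod.ext_iff.mp h
  change g _ = g' _ at h1 h2
  refine Quotient.sound (QuotientGroup.leftRel_apply.mpr ?_)
  rw [mem_fixingSubgroup_iff]
  intro i hi
  rw [Equiv.Perm.smul_def, Equiv.Perm.mul_apply, Equiv.Perm.inv_eq_iff_eq]
  have hi' : i = ⟨p - 2, by omega⟩ ∨ i = ⟨p - 1, by omega⟩ := by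
    simp only [Set.mem_ofPred_eq] at hi
    simp only [Fin.ext_iff]
    omega
  rcases hi' with rfl | rfl
  · exact h1.symm
  · exact h2.symm

lemma mem_range_lastTwo (z : Fin p × Fin p) : z ∈ Set.range (lastTwo p hp) ↔ z.1 ≠ z.2 := by
  have hne : (⟨p - 2, by omega⟩ : Fin p) ≠ ⟨p - 1, by omega⟩ := by
    simp only [ne_eq, Fin.ext_iff]
    omega
  constructor
  · rintro ⟨s, rfl⟩
    induction s using Quotient.inductionOn with | _ g
    exact g.injective.ne hne
  · intro hz
    obtain ⟨g, h1, h2⟩ := MulAction.is_two_pretransitive_iff.mp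
      (Equiv.Perm.isMultiplyPretransitive (Fin p) 2) hne hz
    exact ⟨QuotientGroup.mk g, Prod.ext h1 h2⟩

end Cosets

/-! ### Invertibility of J ⊗ J and the flasque resolution. -/

section Main

variable (G X : Type) [Group G] [MulAction G X] [Fintype X]

/-- The coordinates and the roots of `J_X`. -/
def latticeJFrame : Frame (latticeJ G X) X where
  coord := coord G
  root y x := Module.Dual.eval ℤ _ (root G y x)
  apply_coord := latticeJ_coord G
  root_apply g y x v := latticeJ_apply_root G g v y x
  root_sub_root y x o := by rw [← map_sub, root_sub_root]
  root_coord i y x := coord_root G i y x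
  sum_coord := sum_coord G
  sum_root_smul_coord v o := eq_sum_coord G v o

variable (X : Type) [Fintype X] [DecidableEq X]

/-- Primality enters here: it makes |X| coprime to the number (|X| - 1)! of full cycles. -/
lemma isInvertible_latticeJJ (h : (Fintype.card X).Prime) :
    IsInvertible (latticeJJ (Equiv.Perm X) X) := by
  have : Nonempty X := Fintype.card_pos_iff.mp h.pos
  have h1 := (latticeJFrame (Equiv.Perm X) X).factorsThroughPermutation_card
  have h2 := (latticeJFrame (Equiv.Perm X) X).factorsThroughPermutation_card_fullCycle
  have hcop : IsCoprime (Fintype.card X : ℤ) (Fintype.card (FullCycle X) : ℤ) := by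
    rw [FullCycle.card_eq h.two_le, Nat.isCoprime_iff_coprime]
    exact h.coprime_factorial_of_lt (Nat.sub_one_lt h.ne_zero)
  exact .of_factorsThroughPermutation (isLattice_latticeJJ _) (.id_of_isCoprime hcop h1 h2)

lemma tensorProj_surjective (G X : Type) [Group G] [MulAction G X] [Fintype X] [Nonempty X] :
    Function.Surjective (tensorProj G X) :=
  LinearMap.lTensor_surjective _ (permToJ_surjective G)

lemma tensorInl_tensorProj_exact (G X : Type) [Group G] [MulAction G X] [Fintype X] [Nonempty X] :
    Function.Exact (tensorInl G X) (tensorProj G X) := by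
  have h := lTensor_exact (Module.Dual ℤ (augKer G X).toSubmodule) (f := (orbitSum G X).toLinearMap)
    (g := (permToJ G X).toLinearMap) (orbitSum_permToJ_exact G) (permToJ_surjective G)
  intro t
  refine (h t).trans ⟨?_, ?_⟩
  · rintro ⟨u, rfl⟩
    exact ⟨TensorProduct.rid ℤ _ u, congrArg ((orbitSum G X).toLinearMap.lTensor _)
      ((TensorProduct.rid ℤ _).symm_apply_apply u)⟩
  · rintro ⟨j, rfl⟩
    exact ⟨(TensorProduct.rid ℤ _).symm j, rfl⟩

/-- J_X is free, hence flat, so tensoring preserves the injectivity of ℤ → ℤ[X]. -/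
lemma tensorInl_injective (G X : Type) [Group G] [MulAction G X] [Fintype X] [Nonempty X] :
    Function.Injective (tensorInl G X) := by
  have := (isLattice_latticeJ G (X := X)).free
  have hinj : Function.Injective (orbitSum G X).toLinearMap := fun c c' h => by
    classical
    have := congrArg (fun v : ℤ[X] => v.coeff (Classical.arbitrary X))
      (((orbitSum_apply G c).symm.trans h).trans (orbitSum_apply G c'))
    simpa [MonoidAlgebra.coeff_sum, Finsupp.single_apply] using this
  exact (Module.Flat.lTensor_preserves_injective_linearMap _ hinj).comp
    (TensorProduct.rid ℤ _).symm.injective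

lemma isFlasqueResolution_tensor {G X S : Type} [Group G] [Finite G] [MulAction G X] [Fintype X]
    [Nonempty X] [MulAction G S] [Finite S]
    (φ : ((latticeJ G X).tprod (Representation.ofMulAction ℤ G X)).Equiv
      (Representation.ofMulAction ℤ G S)) (hJ : IsInvertible (latticeJJ G X)) :
    IsFlasqueResolution (φ.toIntertwiningMap.comp (tensorInl G X))
      ((tensorProj G X).comp φ.symm.toIntertwiningMap) where
  lattice := isLattice_latticeJ G
  permutation := isPermutation_ofMulAction S
  flasque := hJ.isFlasque
  injective := φ.toLinearEquiv.injective.comp (tensorInl_injective G X)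
  exact y := by
    refine (tensorInl_tensorProj_exact G X (φ.symm y)).trans ⟨?_, ?_⟩
    · rintro ⟨j, hj⟩
      exact ⟨j, (congrArg φ hj).trans (φ.apply_symm_apply y)⟩
    · rintro ⟨j, rfl⟩
      exact ⟨j, (φ.symm_apply_apply _).symm⟩
  surjective := (tensorProj_surjective G X).comp φ.symm.toLinearEquiv.surjective

end Main

end GLattice

end

open GLattice in
theorem mainTheorem12 (p : ℕ) (hp : p.Prime) (hodd : Odd p) :
    (∃ φ : ((latticeJ (Equiv.Perm (Fin p)) (Fin p)).tprod
          (Representation.ofMulAction ℤ (Equiv.Perm (Fin p)) (Fin p))).Equiv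
        (Representation.ofMulAction ℤ (Equiv.Perm (Fin p))
          (Equiv.Perm (Fin p) ⧸ symSubgroup p (p - 2))),
      IsFlasqueResolution
        (φ.toIntertwiningMap.comp (tensorInl (Equiv.Perm (Fin p)) (Fin p)))
        ((tensorProj (Equiv.Perm (Fin p)) (Fin p)).comp φ.symm.toIntertwiningMap)) ∧
    IsInvertible (latticeJJ (Equiv.Perm (Fin p)) (Fin p)) := by
  have hinv : IsInvertible (latticeJJ (Equiv.Perm (Fin p)) (Fin p)) :=
    isInvertible_latticeJJ (Fin p) (by simpa using hp)
  have : Nonempty (Fin p) := ⟨⟨0, hp.pos⟩⟩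
  have := Fintype.ofFinite (Equiv.Perm (Fin p) ⧸ symSubgroup p (p - 2))
  exact ⟨⟨(latticeJFrame (Equiv.Perm (Fin p)) (Fin p)).tensorEquiv (lastTwo p hp.two_le)
    (lastTwo_injective _) (mem_range_lastTwo _) (lastTwo_smul _),
    isFlasqueResolution_tensor _ hinv⟩, hinv⟩
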